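/- A digraph is a pair $\Gamma=(V,A)$ with $V$ a non-empty set and $A\subseteq V\times V$; it is regular if there is an integer $d\ge 0$ such that every vertex has exactly $d$ out-neighbours and exactly $d$ in-neighbours, and $\mathrm{Aut}(\Gamma)$ is the group of all permutations $\sigma$ of $V$ such that $(\sigma(u),\sigma(v))\in A$ if and only if $(u,v)\in A$. For a group $G$ and a positive integer $n$, an $n$-partite digraphical representation ($n$-PDR) of $G$ is a regular digraph $\Gamma$ such that $\mathrm{Aut}(\Gamma)$ is isomorphic to $G$, every vertex has trivial stabiliser in $\mathrm{Aut}(\Gamma)$, $\mathrm{Aut}(\Gamma)$ has exactly $n$ orbits on the vertex set, and no arc of $\Gamma$ has both ends in the same orbit. Lemma. If a finite group $G$ admits a $2$-PDR, then $G$ admits an $n$-PDR for every integer $n\ge 2$. -/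

import Mathlib

namespace Digraph

/-- The automorphism group of a digraph: the permutations `σ` of the vertex set such that
`(σ u, σ v)` is an arc if and only if `(u, v)` is an arc, under composition. It acts on the
vertices by evaluation. -/
abbrev Aut {V : Type*} (Γ : Digraph V) : Type _ := Γ.Adj ≃r Γ.Adj

/-- A digraph is regular if, for some natural number `d`, every vertex has exactly `d`
out-neighbours and exactly `d` in-neighbours. -/
def IsRegular {V : Type*} (Γ : Digraph V) : Prop :=
  ∃ d : ℕ, ∀ v : V, {w : V | Γ.Adj v w}.encard = d ∧ {u : V | Γ.Adj u v}.encard = d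

/-- `Γ` is an `n`-partite digraphical representation (`n`-PDR) of the group `G`. -/
structure IsPDR {V : Type*} (Γ : Digraph V) (G : Type*) [Group G] (n : ℕ) : Prop where
  /-- a digraph has at least one vertex -/
  nonempty : Nonempty V
  regular : Γ.IsRegular
  /-- the automorphism group is isomorphic to `G` -/
  iso : Nonempty (Γ.Aut ≃* G)
  /-- the automorphism group acts semiregularly: all vertex stabilisers are trivial -/
  semiregular : ∀ v : V, MulAction.stabilizer Γ.Aut v = ⊥
  /-- the automorphism group has exactly `n` orbits on the vertices -/
  orbits : ENat.card (MulAction.orbitRel.Quotient Γ.Aut V) = n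
  /-- no arc (in particular no loop) joins two vertices of the same orbit -/
  no_arc : ∀ u v : V, u ∈ MulAction.orbit Γ.Aut v → ¬ Γ.Adj u v

end Digraph

/-- The group `G` admits an `n`-PDR. A representation of a finite group has finitely many
vertices, so vertex sets in the lowest universe suffice, whatever the universe of `G`. -/
def AdmitsPDR (G : Type*) [Group G] (n : ℕ) : Prop :=
  ∃ (V : Type) (Γ : Digraph V), Γ.IsPDR G n

/-! A PDR of a finite group is a digraph on `ι × A` given by connection sets, whose only
automorphisms are the left multiplications. Orbits are added one at a time
(`IsExtendable.exists_option`), each new orbit sending and receiving `d` arcs between every vertex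
and every old orbit, so regularity persists. The arcs are chosen so that the number of unreversed
out-arcs (`skewDegree`) separates the new orbit from all the old ones. An automorphism then
restricts to the old part, where it is left multiplication by some `g`; the arcs from two old orbits
pin down each new vertex (`IsRigid.extend`). The invariant `skewDegree_ne` keeps such a choice
available. -/

open Finset

namespace Digraph

/-! ### Digraphs given by connection sets, and their equivalence with PDRs. -/

variable {ι A : Type} [Group A]

/-- The digraph on `ι × A` with an arc from `(i, a)` to `(j, b)` when `a⁻¹ * b ∈ S i j`; the group
`A` acts on it by left multiplication, with orbits indexed by `ι`. -/
def multiCayley (S : ι → ι → Finset A) : Digraph (ι × A) where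
  Adj u v := u.2⁻¹ * v.2 ∈ S u.1 v.1

theorem multiCayley_adj (S : ι → ι → Finset A) (u v : ι × A) :
    (multiCayley S).Adj u v ↔ u.2⁻¹ * v.2 ∈ S u.1 v.1 := Iff.rfl

/-- Every automorphism of `multiCayley S` is a left multiplication. -/
def IsRigid (S : ι → ι → Finset A) : Prop :=
  ∀ φ : (multiCayley S).Aut, ∃ g : A, ∀ u, φ u = (u.1, g * u.2)

/-- Left multiplication as an automorphism of `multiCayley S`. -/
def leftMul (S : ι → ι → Finset A) : A →* (multiCayley S).Aut where
  toFun g :=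
    { toEquiv := (Equiv.refl ι).prodCongr (Equiv.mulLeft g)
      map_rel_iff' := by
        intro u v
        simp [multiCayley_adj, mul_assoc] }
  map_one' := by ext u <;> simp
  map_mul' g h := by ext u <;> simp [mul_assoc]

theorem leftMul_apply (S : ι → ι → Finset A) (g : A) (u : ι × A) :
    leftMul S g u = (u.1, g * u.2) := rfl

theorem leftMul_bijective [Nonempty ι] {S : ι → ι → Finset A} (hS : IsRigid S) :
    Function.Bijective (leftMul S) := by
  constructor
  · intro g h hgh
    obtain ⟨i⟩ := ‹Nonempty ι›
    simpa [leftMul_apply] using congrArg (fun φ : (multiCayley S).Aut => φ (i, 1)) hgh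
  · intro φ
    obtain ⟨g, hg⟩ := hS φ
    exact ⟨g, by ext u <;> simp [hg, leftMul_apply]⟩

theorem mem_orbit_multiCayley {S : ι → ι → Finset A} (hS : IsRigid S) (u v : ι × A) :
    u ∈ MulAction.orbit (multiCayley S).Aut v ↔ u.1 = v.1 := by
  constructor
  · rintro ⟨φ, rfl⟩
    obtain ⟨g, hg⟩ := hS φ
    change (φ v).1 = v.1
    rw [hg]
  · intro h
    refine ⟨leftMul S (u.2 * v.2⁻¹), ?_⟩
    change leftMul S (u.2 * v.2⁻¹) v = u
    rw [leftMul_apply, inv_mul_cancel_right, ← h]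

theorem card_filter_translate [Fintype ι] [Fintype A] (a : A) (P : ι → A → Prop)
    [∀ i, DecidablePred (P i)] :
    #{v : ι × A | P v.1 (a⁻¹ * v.2)} = ∑ i, #{x | P i x} := by
  simp only [card_filter, Fintype.sum_prod_type]
  refine sum_congr rfl fun i _ => ?_
  exact Fintype.sum_equiv (Equiv.mulLeft a⁻¹) _ _ fun x => rfl

theorem card_filter_translate_inv [Fintype ι] [Fintype A] (a : A) (P : ι → A → Prop)
    [∀ i, DecidablePred (P i)] :
    #{v : ι × A | P v.1 (v.2⁻¹ * a)} = ∑ i, #{x | P i x} := by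
  simp only [card_filter, Fintype.sum_prod_type]
  refine sum_congr rfl fun i _ => ?_
  exact Fintype.sum_equiv ((Equiv.inv A).trans (Equiv.mulRight a)) _ _ fun x => rfl

theorem encard_out_multiCayley [Fintype ι] [Fintype A] (S : ι → ι → Finset A) (u : ι × A) :
    {w | (multiCayley S).Adj u w}.encard = (∑ j, #(S u.1 j) : ℕ) := by
  classical
  have := card_filter_translate u.2 (fun j x => x ∈ S u.1 j)
  simp only [filter_mem_eq_inter, univ_inter] at this
  rw [← this, ← Set.encard_coe_eq_coe_finsetCard]
  simp [multiCayley_adj]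

theorem encard_in_multiCayley [Fintype ι] [Fintype A] (S : ι → ι → Finset A) (u : ι × A) :
    {w | (multiCayley S).Adj w u}.encard = (∑ j, #(S j u.1) : ℕ) := by
  classical
  have := card_filter_translate_inv u.2 (fun j x => x ∈ S j u.1)
  simp only [filter_mem_eq_inter, univ_inter] at this
  rw [← this, ← Set.encard_coe_eq_coe_finsetCard]
  simp [multiCayley_adj]

theorem IsRigid.isPDR [Fintype ι] [Fintype A] [Nonempty ι] {G : Type*} [Group G] (e : A ≃* G)
    {S : ι → ι → Finset A} (hS : IsRigid S) (hloop : ∀ i, S i i = ∅) {D : ℕ}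
    (hout : ∀ i, ∑ j, #(S i j) = D) (hin : ∀ i, ∑ j, #(S j i) = D) :
    (multiCayley S).IsPDR G (Fintype.card ι) where
  nonempty := inferInstance
  regular := ⟨D, fun v => by
    rw [encard_out_multiCayley, encard_in_multiCayley, hout, hin]; exact ⟨rfl, rfl⟩⟩
  iso := ⟨(MulEquiv.ofBijective _ (leftMul_bijective hS)).symm.trans e⟩
  semiregular v := by
    rw [eq_bot_iff]
    intro φ hφ
    obtain ⟨g, hg⟩ := hS φ
    have h1 : φ v = v := hφ
    have h2 : g = 1 := by simpa using congrArg Prod.snd ((hg v).symm.trans h1)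
    rw [Subgroup.mem_bot]
    ext u <;> simp [hg, h2]
  orbits := by
    have e : MulAction.orbitRel.Quotient (multiCayley S).Aut (ι × A) ≃ ι :=
      { toFun := Quotient.lift Prod.fst fun u v h => (mem_orbit_multiCayley hS u v).1 h
        invFun := fun i => Quotient.mk _ (i, 1)
        left_inv := by
          rintro ⟨u⟩
          exact Quotient.sound ((mem_orbit_multiCayley hS _ _).2 rfl)
        right_inv := fun i => rfl }
    rw [ENat.card_congr e, ENat.card_eq_coe_fintype_card]
  no_arc u v h := by
    rw [mem_orbit_multiCayley hS] at h
    simp [multiCayley_adj, h, hloop]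

/-- Since the stabilisers are trivial, a choice of orbit representatives identifies the vertices
with orbits times `Γ.Aut`. Rigidity holds because the acting group is the whole automorphism group.
-/
theorem IsPDR.exists_multiCayley {V : Type} {Γ : Digraph V} {G : Type*} [Group G] [Finite G]
    {n : ℕ} (h : Γ.IsPDR G n) :
    ∃ (ι A : Type) (_ : Fintype ι) (_ : Group A) (_ : Fintype A) (_ : A ≃* G)
      (S : ι → ι → Finset A) (D : ℕ), Fintype.card ι = n ∧ IsRigid S ∧ (∀ i, S i i = ∅) ∧
      (∀ i, ∑ j, #(S i j) = D) ∧ ∀ i, ∑ j, #(S j i) = D := by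
  classical
  obtain ⟨e⟩ := h.iso
  have : Finite Γ.Aut := Finite.of_equiv _ e.symm.toEquiv
  have : Finite (MulAction.orbitRel.Quotient Γ.Aut V) := by
    rw [← ENat.card_lt_top, h.orbits]; exact ENat.natCast_lt_top n
  let Q := MulAction.orbitRel.Quotient Γ.Aut V
  let _ : Fintype Q := Fintype.ofFinite _
  let _ : Fintype Γ.Aut := Fintype.ofFinite _
  let r : Q → V := Quotient.out
  have hr : ∀ q, (Quotient.mk _ (r q) : Q) = q := Quotient.out_eq
  have hsmul : ∀ (a : Γ.Aut) (v : V), (Quotient.mk _ (a • v) : Q) = Quotient.mk _ v :=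
    fun a v => Quotient.sound (MulAction.mem_orbit v a)
  let f : Q × Γ.Aut → V := fun u => u.2 • r u.1
  have hf : Function.Bijective f := by
    constructor
    · rintro ⟨q, a⟩ ⟨q', a'⟩ hq
      have hq : a • r q = a' • r q' := hq
      have h1 : q = q' := by rw [← hr q, ← hr q', ← hsmul a, hq, hsmul]
      subst h1
      have h2 : a'⁻¹ * a ∈ MulAction.stabilizer Γ.Aut (r q) := by
        rw [MulAction.mem_stabilizer_iff, mul_smul, hq, inv_smul_smul]
      rw [h.semiregular, Subgroup.mem_bot, inv_mul_eq_one] at h2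
      rw [h2]
    · intro v
      have h1 : MulAction.orbitRel Γ.Aut V v (r (Quotient.mk _ v)) :=
        Quotient.exact (hr (Quotient.mk _ v)).symm
      obtain ⟨a, ha⟩ := h1
      exact ⟨(Quotient.mk _ v, a), ha⟩
  let E := Equiv.ofBijective f hf
  have hadj : ∀ (a : Γ.Aut) (u v : V), Γ.Adj (a • u) (a • v) ↔ Γ.Adj u v :=
    fun a u v => a.map_rel_iff
  let S : Q → Q → Finset Γ.Aut := fun i j => {x | Γ.Adj (r i) (x • r j)}
  have hS : ∀ u v, (multiCayley S).Adj u v ↔ Γ.Adj (E u) (E v) := by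
    intro u v
    change _ ↔ Γ.Adj (u.2 • r u.1) (v.2 • r v.1)
    rw [← hadj u.2⁻¹, inv_smul_smul, smul_smul]
    simp [multiCayley_adj, S]
  have key : ∀ u, ((∑ j, #(S u.1 j) : ℕ) : ℕ∞) = {w | Γ.Adj (E u) w}.encard ∧
      ((∑ j, #(S j u.1) : ℕ) : ℕ∞) = {w | Γ.Adj w (E u)}.encard := by
    intro u
    rw [← encard_out_multiCayley, ← encard_in_multiCayley]
    constructor
    · rw [← E.symm.injective.encard_image, E.symm.image_eq_preimage_symm]; simp [hS]
    · rw [← E.symm.injective.encard_image, E.symm.image_eq_preimage_symm]; simp [hS]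
  obtain ⟨D, hD⟩ := h.regular
  refine ⟨Q, Γ.Aut, inferInstance, inferInstance, inferInstance, e, S, D, ?_, ?_, ?_, ?_, ?_⟩
  · have := h.orbits
    rw [ENat.card_eq_coe_fintype_card] at this
    exact_mod_cast this
  · intro φ
    let σ : Γ.Aut :=
      { toEquiv := (E.symm.trans φ.toEquiv).trans E
        map_rel_iff' := by
          intro u v
          have := φ.map_rel_iff (a := E.symm u) (b := E.symm v)
          rw [hS, hS] at this
          simpa using this }
    refine ⟨σ, fun u => E.injective ?_⟩
    have h1 : E (φ u) = σ • E u := by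
      change _ = E (φ (E.symm (E u)))
      rw [E.symm_apply_apply]
    rw [h1]
    change σ • u.2 • r u.1 = (σ * u.2) • r u.1
    rw [mul_smul]
  · intro i
    refine eq_empty_of_forall_notMem fun x hx => ?_
    refine h.no_arc (r i) (x • r i) ?_ (by simpa [S] using hx)
    exact MulAction.mem_orbit_symm.1 (MulAction.mem_orbit _ _)
  · intro i
    have := (key (i, 1)).1.trans (hD _).1
    exact_mod_cast this
  · intro i
    have := (key (i, 1)).2.trans (hD _).2
    exact_mod_cast this

/-- If `d` were `0` or `|A|`, adjacency would depend only on whether the orbits differ, and swapping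
two orbits would be an automorphism. -/
theorem card_pos_and_lt_of_isRigid [Fintype ι] [Fintype A] {S : ι → ι → Finset A}
    (hS : IsRigid S) (hloop : ∀ i, S i i = ∅) {d : ℕ} (hd : ∀ i j, i ≠ j → #(S i j) = d)
    (hι : 1 < Fintype.card ι) : 0 < d ∧ d < Fintype.card A := by
  classical
  obtain ⟨i₀, i₁, hne⟩ := Fintype.one_lt_card_iff.1 hι
  have main : ∀ p : Prop, ¬ ∀ i j, i ≠ j → ∀ x, x ∈ S i j ↔ p := by
    intro p hp
    have hadj : ∀ u v, (multiCayley S).Adj u v ↔ u.1 ≠ v.1 ∧ p := by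
      intro u v
      rw [multiCayley_adj]
      by_cases h : u.1 = v.1
      · simp [h, hloop]
      · simp [h, hp _ _ h]
    let φ : (multiCayley S).Aut :=
      { toEquiv := (Equiv.swap i₀ i₁).prodCongr (Equiv.refl A)
        map_rel_iff' := by
          intro u v
          simp [hadj] }
    obtain ⟨g, hg⟩ := hS φ
    have h1 : Equiv.swap i₀ i₁ i₀ = i₀ := congrArg Prod.fst (hg (i₀, 1))
    rw [Equiv.swap_apply_left] at h1
    exact hne h1.symm
  constructor
  · rw [Nat.pos_iff_ne_zero]
    rintro rfl
    refine main False fun i j hij x => ?_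
    simp [card_eq_zero.1 (hd i j hij)]
  · refine lt_of_le_of_ne ((hd i₀ i₁ hne).symm.trans_le (card_le_univ _)) ?_
    rintro rfl
    refine main True fun i j hij x => ?_
    simp [(card_eq_iff_eq_univ _).1 (hd i j hij)]

theorem sum_eq_add_of_card_eq_two {ι : Type*} [Fintype ι] (hι : Fintype.card ι = 2) {i j : ι} (hij : i ≠ j)
    (f : ι → ℕ) : ∑ k, f k = f i + f j := by
  classical
  have : (univ : Finset ι) = {i, j} :=
    (eq_of_subset_of_card_le (subset_univ _) (by rw [card_pair hij, card_univ, hι])).symm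
  rw [this, sum_pair hij]

/-- Exchange `k` elements of `X` for `k` elements outside it. -/
theorem exists_card_eq_card_sdiff_eq {α : Type*} [Fintype α] [DecidableEq α] (X : Finset α) {k : ℕ}
    (h1 : k ≤ #X) (h2 : k ≤ #Xᶜ) : ∃ Y : Finset α, #Y = #X ∧ #(X \ Y) = k ∧ #(Y \ X) = k := by
  obtain ⟨Z, hZ, hZk⟩ := exists_subset_card_eq h1
  obtain ⟨W, hW, hWk⟩ := exists_subset_card_eq h2
  have hWX : Disjoint W X := disjoint_left.2 fun a ha => by simpa using hW ha
  have e1 : X \ (X \ Z ∪ W) = Z := by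
    ext a
    have := @hZ a
    have := @hW a
    simp at *
    tauto
  have e2 : (X \ Z ∪ W) \ X = W := by
    ext a
    have := @hW a
    simp at *
    tauto
  refine ⟨X \ Z ∪ W, ?_, by rw [e1, hZk], by rw [e2, hWk]⟩
  rw [card_union_of_disjoint (hWX.symm.mono_left sdiff_subset), card_sdiff_of_subset hZ]
  omega

/-! ### Skew degrees and the addition of one orbit. -/

variable [DecidableEq A]

/-- The number of arcs of `multiCayley S` out of a vertex `(i, a)` whose reversal is not an arc. -/
def skewDegree [Fintype ι] (S : ι → ι → Finset A) (i : ι) : ℕ :=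
  ∑ j, #{x ∈ S i j | x⁻¹ ∉ S j i}

/-- Automorphisms preserve unreversed arcs, so orbits with different skew degrees cannot be mixed.
-/
theorem skewDegree_apply [Fintype ι] [Fintype A] {S : ι → ι → Finset A} (φ : (multiCayley S).Aut)
    (u : ι × A) : skewDegree S (φ u).1 = skewDegree S u.1 := by
  classical
  have key : ∀ u : ι × A, skewDegree S u.1 =
      #{v : ι × A | (multiCayley S).Adj u v ∧ ¬ (multiCayley S).Adj v u} := by
    intro u
    have := card_filter_translate u.2 (fun j x => x ∈ S u.1 j ∧ x⁻¹ ∉ S j u.1)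
    simp only [mul_inv_rev, inv_inv] at this
    simp only [multiCayley_adj, this, skewDegree]
    refine sum_congr rfl fun j _ => ?_
    congr 1
    ext x
    simp
  rw [key, key]
  symm
  refine card_equiv φ.toEquiv fun v => ?_
  have h1 := φ.map_rel_iff (a := u) (b := v)
  have h2 := φ.map_rel_iff (a := v) (b := u)
  simp only [mem_filter, mem_univ, true_and]
  rw [← h1, ← h2]
  rfl

theorem skewDegree_le [Fintype ι] (S : ι → ι → Finset A) (i : ι) :
    skewDegree S i ≤ ∑ j, #(S i j) :=
  sum_le_sum fun _ _ => card_le_card (filter_subset _ _)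

/-- Add one orbit to `S`, joined to the orbit `i` by the arcs in `X i` and in `Z i`. -/
def extend (S : ι → ι → Finset A) (X Z : ι → Finset A) : Option ι → Option ι → Finset A
  | some i, some j => S i j
  | some i, none => X i
  | none, some i => Z i
  | none, none => ∅

theorem skewDegree_extend_some [Fintype ι] (S : ι → ι → Finset A)
    (X Z : ι → Finset A) (i : ι) :
    skewDegree (extend S X Z) (some i) = #{x ∈ X i | x⁻¹ ∉ Z i} + skewDegree S i := by
  simp only [skewDegree, Fintype.sum_option, extend]
  rfl

theorem skewDegree_extend_none [Fintype ι] (S : ι → ι → Finset A)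
    (X Z : ι → Finset A) :
    skewDegree (extend S X Z) none = ∑ i, #{x ∈ Z i | x⁻¹ ∉ X i} := by
  simp [skewDegree, Fintype.sum_option, extend]
  rfl

theorem IsRigid.extend [Fintype ι] [Fintype A] {S : ι → ι → Finset A}
    (hS : IsRigid S) {X Z : ι → Finset A}
    (hskew : ∀ i, skewDegree (extend S X Z) (some i) ≠ skewDegree (extend S X Z) none)
    {i₀ i₁ : ι} {x : A} (hx : X i₀ \ X i₁ = {x}) : IsRigid (extend S X Z) := by
  intro φ
  have hsome : ∀ (ψ : (multiCayley (Digraph.extend S X Z)).Aut) (u : ι × A),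
      ∃ w : ι × A, ψ (some u.1, u.2) = (some w.1, w.2) := by
    intro ψ u
    have h := skewDegree_apply ψ (some u.1, u.2)
    rcases hw : ψ (some u.1, u.2) with ⟨_ | i, a⟩
    · rw [hw] at h
      exact absurd h.symm (hskew u.1)
    · exact ⟨(i, a), rfl⟩
  have hnone : ∀ a, ∃ b, φ (none, a) = (none, b) := by
    intro a
    have h := skewDegree_apply φ (none, a)
    rcases hw : φ (none, a) with ⟨_ | i, b⟩
    · exact ⟨b, rfl⟩
    · rw [hw] at h
      exact absurd h (hskew i)
  choose σ hσ using hsome φ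
  choose τ hτ using hsome φ.symm
  have hinj : ∀ u w : ι × A, ((some u.1, u.2) : Option ι × A) = (some w.1, w.2) → u = w := by
    rintro ⟨i, a⟩ ⟨j, b⟩ h
    simpa using h
  let ρ : (multiCayley S).Aut :=
    { toFun := σ
      invFun := τ
      left_inv := fun u => hinj _ _ (by rw [← hτ, ← hσ, RelIso.symm_apply_apply])
      right_inv := fun u => hinj _ _ (by rw [← hσ, ← hτ, RelIso.apply_symm_apply])
      map_rel_iff' := by
        intro u w
        have := φ.map_rel_iff (a := (some u.1, u.2)) (b := (some w.1, w.2))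
        rw [hσ, hσ] at this
        exact this }
  obtain ⟨g, hg⟩ := hS ρ
  have hφ : ∀ i a, φ (some i, a) = (some i, g * a) := by
    intro i a
    have h : σ (i, a) = (i, g * a) := hg (i, a)
    rw [hσ (i, a), h]
  refine ⟨g, ?_⟩
  rintro ⟨_ | i, a⟩
  · obtain ⟨b, hb⟩ := hnone a
    rw [hb]
    have hmem : ∀ i c, (g * c)⁻¹ * b ∈ X i ↔ c⁻¹ * a ∈ X i := by
      intro i c
      have := φ.map_rel_iff (a := (some i, c)) (b := (none, a))
      rw [hφ, hb] at this
      exact this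
    have hx' : x ∈ X i₀ \ X i₁ := by simp [hx]
    -- Only `c = a * x⁻¹` satisfies `c⁻¹ * a ∈ X i₀ \ X i₁`; its image under `g` bears the same
    -- relation to `b`, which forces `b = g * a`.
    have h2 : (g * (a * x⁻¹))⁻¹ * b ∈ X i₀ \ X i₁ := by
      rw [mem_sdiff, hmem, hmem]
      simpa using hx'
    rw [hx, mem_singleton, inv_mul_eq_iff_eq_mul] at h2
    simp [h2, mul_assoc]
  · exact hφ i a

/-- The data carried through the addition of orbits: `S` has `n + 1` orbits, is rigid and loopless,
every vertex has `n * d` out- and in-neighbours, and the extreme skew degrees `0` and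
`n * min d (|A| - d)` do not both occur. -/
structure IsExtendable [Fintype ι] [Fintype A] (S : ι → ι → Finset A) (d n : ℕ) : Prop where
  card_eq : Fintype.card ι = n + 1
  isRigid : IsRigid S
  loopless : ∀ i, S i i = ∅
  sum_out : ∀ i, ∑ j, #(S i j) = n * d
  sum_in : ∀ i, ∑ j, #(S j i) = n * d
  skewDegree_le : ∀ i, skewDegree S i ≤ n * min d (Fintype.card A - d)
  skewDegree_ne : (∀ i, skewDegree S i ≠ 0) ∨
    ∀ i, skewDegree S i ≠ n * min d (Fintype.card A - d)

theorem IsExtendable.exists_option [Fintype ι] [Fintype A] {S : ι → ι → Finset A} {d n : ℕ}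
    (h : IsExtendable S d n) (hn : 0 < n) (hd0 : 0 < d) (hd1 : d < Fintype.card A) :
    ∃ S' : Option ι → Option ι → Finset A, IsExtendable S' d (n + 1) := by
  classical
  set t := min d (Fintype.card A - d) with ht
  have ht0 : 0 < t := by omega
  -- With `k` unreversed arcs in each direction between a vertex and an orbit, the new skew degree
  -- is `(n + 1) * k` and an old one `s` becomes `k + s`; they agree exactly when `s = n * k`.
  obtain ⟨k, hkt, hk⟩ : ∃ k, (k = 0 ∨ k = t) ∧ ∀ i, skewDegree S i ≠ n * k := by
    rcases h.skewDegree_ne with h0 | h0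
    · exact ⟨0, Or.inl rfl, by simpa using h0⟩
    · exact ⟨t, Or.inr rfl, h0⟩
  have hkt' : k ≤ t := by rcases hkt with rfl | rfl <;> omega
  obtain ⟨X₀, -, hX₀⟩ := exists_subset_card_eq (s := (univ : Finset A)) (by simpa using hd1.le)
  obtain ⟨X₁, hX₁, hsd, -⟩ := exists_card_eq_card_sdiff_eq X₀ (k := 1) (by omega)
    (by rw [card_compl]; omega)
  obtain ⟨x, hx⟩ := card_eq_one.1 hsd
  obtain ⟨i₀, i₁, hne⟩ := Fintype.one_lt_card_iff.1 (show 1 < Fintype.card ι by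
    rw [h.card_eq]; omega)
  let X : ι → Finset A := fun i => if i = i₀ then X₀ else X₁
  have hX : ∀ i, #(X i) = d := by
    intro i
    by_cases hi : i = i₀ <;> simp [X, hi, hX₁, hX₀]
  have hY : ∀ i, ∃ Y : Finset A, #Y = #(X i) ∧ #(X i \ Y) = k ∧ #(Y \ X i) = k := fun i =>
    exists_card_eq_card_sdiff_eq (X i) (by rw [hX]; omega) (by rw [card_compl, hX]; omega)
  choose Y hYX hXY hYX' using hY
  -- The reversal of an arc in `X i` is an arc exactly when its element lies in `Y i`.
  let Z : ι → Finset A := fun i => (Y i).map (Equiv.inv A).toEmbedding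
  have hmemZ : ∀ i a, a ∈ Z i ↔ a⁻¹ ∈ Y i := by
    intro i a
    simp [Z, mem_map_equiv]
  have hZ : ∀ i, #(Z i) = d := fun i => by simp [Z, hYX, hX]
  have hsome : ∀ i, skewDegree (extend S X Z) (some i) = k + skewDegree S i := by
    intro i
    rw [skewDegree_extend_some, ← hXY i, sdiff_eq_filter]
    simp [hmemZ]
  have hnone : skewDegree (extend S X Z) none = (n + 1) * k := by
    rw [skewDegree_extend_none, ← h.card_eq, ← smul_eq_mul, ← card_univ]
    refine sum_eq_card_nsmul fun i _ => ?_
    rw [← hYX' i]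
    refine card_equiv (Equiv.inv A) fun a => ?_
    simp [hmemZ]
  refine ⟨extend S X Z, ?_, ?_, ?_, ?_, ?_, ?_, ?_⟩
  · simp [h.card_eq]
  · refine h.isRigid.extend ?_ (i₀ := i₀) (i₁ := i₁) (x := x) ?_
    · intro i
      rw [hsome, hnone]
      have := hk i
      lia
    · simpa [X, hne.symm] using hx
  · rintro (_ | i)
    · rfl
    · exact h.loopless i
  · rintro (_ | i)
    · simp [Fintype.sum_option, extend, hZ, h.card_eq]
    · simp only [Fintype.sum_option, extend, hX, h.sum_out]
      ring
  · rintro (_ | i)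
    · simp [Fintype.sum_option, extend, hX, h.card_eq]
    · simp only [Fintype.sum_option, extend, hZ, h.sum_in]
      ring
  · rintro (_ | i)
    · rw [hnone]
      exact Nat.mul_le_mul_left _ hkt'
    · rw [hsome, add_mul, one_mul, add_comm]
      exact add_le_add (h.skewDegree_le i) hkt'
  · rw [← ht]
    have hlt : n * t < (n + 1) * t := by nlinarith
    -- For `k = 0` every skew degree is at most `n * t`, below the new maximum; for `k = t` every
    -- one is positive.
    rcases hkt with rfl | rfl
    · right
      rintro (_ | i)
      · rw [hnone]; omega
      · rw [hsome]
        have := h.skewDegree_le i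
        rw [← ht] at this
        omega
    · left
      rintro (_ | i)
      · rw [hnone]; positivity
      · rw [hsome]; omega

theorem isExtendable_of_card_eq_two [Fintype ι] [Fintype A] {S : ι → ι → Finset A} {d : ℕ}
    (hι : Fintype.card ι = 2) (hS : IsRigid S) (hloop : ∀ i, S i i = ∅)
    (hout : ∀ i, ∑ j, #(S i j) = d) (hin : ∀ i, ∑ j, #(S j i) = d) :
    0 < d ∧ d < Fintype.card A ∧ IsExtendable S d 1 := by
  classical
  have hd : ∀ i j, i ≠ j → #(S i j) = d := by
    intro i j hij
    have := hout i
    rw [sum_eq_add_of_card_eq_two hι hij, hloop] at this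
    simpa using this
  obtain ⟨hd0, hd1⟩ := card_pos_and_lt_of_isRigid hS hloop hd (by omega)
  have hskew : ∀ i j, i ≠ j → skewDegree S i = #{x ∈ S i j | x⁻¹ ∉ S j i} := by
    intro i j hij
    rw [skewDegree, sum_eq_add_of_card_eq_two hι hij, hloop]
    simp
  have hother : ∀ i : ι, ∃ j, i ≠ j := fun i => by
    obtain ⟨j, hj⟩ := Fintype.exists_ne_of_one_lt_card (by omega) i
    exact ⟨j, hj.symm⟩
  -- Inversion matches the reversed arcs of the two directions, and both directions have `d` arcs in
  -- all. A constant skew degree cannot take both extreme values.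
  have hconst : ∀ i j, skewDegree S i = skewDegree S j := by
    intro i j
    by_cases hij : i = j
    · rw [hij]
    rw [hskew i j hij, hskew j i (Ne.symm hij)]
    have h1 := card_filter_add_card_filter_not (s := S i j) (fun x => x⁻¹ ∈ S j i)
    have h2 := card_filter_add_card_filter_not (s := S j i) (fun x => x⁻¹ ∈ S i j)
    rw [hd i j hij] at h1
    rw [hd j i (Ne.symm hij)] at h2
    have h3 : #{x ∈ S i j | x⁻¹ ∈ S j i} = #{x ∈ S j i | x⁻¹ ∈ S i j} :=
      card_equiv (Equiv.inv A) fun x => by simp [and_comm]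
    omega
  refine ⟨hd0, hd1, hι, hS, hloop, by simpa using hout, by simpa using hin, ?_, ?_⟩
  · intro i
    rw [one_mul]
    refine le_min ((skewDegree_le S i).trans_eq (hout i)) ?_
    obtain ⟨j, hij⟩ := hother i
    -- Inverses of unreversed elements lie in the complement of `S j i`.
    rw [hskew i j hij, ← hd j i hij.symm, ← card_compl]
    refine card_le_card_of_injOn (·⁻¹) ?_ inv_injective.injOn
    intro x hx
    simp at hx ⊢
    exact hx.2
  · by_cases h : ∃ i, skewDegree S i = 0
    · obtain ⟨i, hi⟩ := h
      right
      intro j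
      rw [hconst j i, hi]
      omega
    · left
      simpa using h

end Digraph

theorem lemma3p1 {G : Type*} [Group G] [Finite G] (h : AdmitsPDR G 2) :
    ∀ n : ℕ, 2 ≤ n → AdmitsPDR G n := by
  intro n hn
  obtain ⟨V, Γ, hΓ⟩ := h
  obtain ⟨ι, A, _, _, _, e, S, d, hι, hS, hloop, hout, hin⟩ := hΓ.exists_multiCayley
  classical
  obtain ⟨hd0, hd1, hext⟩ := Digraph.isExtendable_of_card_eq_two hι hS hloop hout hin
  have key : ∀ m, 1 ≤ m → ∃ (κ : Type) (_ : Fintype κ) (T : κ → κ → Finset A),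
      Digraph.IsExtendable T d m := by
    intro m hm
    induction m, hm using Nat.le_induction with
    | base => exact ⟨ι, _, S, hext⟩
    | succ m hm ih =>
      obtain ⟨κ, _, T, hT⟩ := ih
      exact ⟨Option κ, _, hT.exists_option hm hd0 hd1⟩
  -- The parameter of `IsExtendable` is one less than the number of orbits.
  obtain ⟨κ, _, T, hT⟩ := key (n - 1) (by omega)
  have hκ : Fintype.card κ = n := by rw [hT.card_eq]; omega
  have : Nonempty κ := Fintype.card_pos_iff.1 (by omega)
  exact ⟨_, _, hκ ▸ hT.isRigid.isPDR e hT.loopless hT.sum_out hT.sum_in⟩
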